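/- Let $n\ge 1$ and $m\ge 0$ be integers. The Yoke graph $Y(n,m)$ is the simple graph whose vertices are the tuples $u=(u_0,u_1,\dots,u_{m+1})\in\mathbb{Z}_n\times\{0,1\}^m\times\mathbb{Z}_n$ with $\sum_{i=0}^{m+1}u_i\equiv 0\pmod n$. Here $\{0,1\}\subseteq\mathbb{Z}$, and the elements of $\mathbb{Z}_n=\mathbb{Z}/n\mathbb{Z}$ are identified with $0,1,\dots,n-1$. Two distinct vertices $u,v$ are adjacent if for some $0\le i\le m$ we have $u_j=v_j$ for all $j\notin\{i,i+1\}$ and either $u_i=v_i+1,\ u_{i+1}=v_{i+1}-1$, or $u_i=v_i-1,\ u_{i+1}=v_{i+1}+1$, where these equalities are taken in $\mathbb{Z}_n$ for the two end entries (indices $0$ and $m+1$) and in $\mathbb{Z}$ for all other entries. Then $Y(n,m)$ has the following (finite) diameter. - If $m\le n$, then $$\operatorname{diam}Y(n,m)=\left\lfloor\frac{n(m+1)}{2}\right\rfloor .$$ - If $1=n\le m$, then $$\operatorname{diam}Y(n,m)=\binom{\lceil m/2\rceil+1}{2}+\binom{\lfloor m/2\rfloor+1}{2}.$$ - If $1<n\le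 m$, put $$d_0=\binom{\lfloor (m+n)/2\rfloor+1}{2}+\binom{\lceil (m-n)/2\rceil+1}{2}.$$ If $2\mid (m-n)$ or $n\le\lceil (m+1)/2\rceil$, then $\operatorname{diam}Y(n,m)=d_0$; otherwise $$\operatorname{diam}Y(n,m)=d_0+n-\left\lceil\frac{m+1}{2}\right\rceil .$$ -/

import Mathlib

/-- The two end positions `0` and `m + 1` (the buckets) of a sequence `(u₀, …, u_{m+1})`. -/
def IsBucket {m : ℕ} (j : Fin (m + 2)) : Prop :=
  j = 0 ∨ j = Fin.last (m + 1)

open Classical in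
/-- Equality of two values of the entry in position `j`: the buckets take values in `ℤ / nℤ`,
represented by integers, and the other entries are honest integers. -/
def EntryEq (n : ℕ) {m : ℕ} (j : Fin (m + 2)) (a b : ℤ) : Prop :=
  if IsBucket j then a ≡ b [ZMOD n] else a = b

/-- `u` is a vertex of the Yoke graph `Y(n, m)`: the buckets are elements of `ℤ / nℤ`, identified
with their smallest non-negative representatives, the other entries are `0` or `1`, and the sum of
all entries is divisible by `n`. -/
structure IsYokeVertex (n m : ℕ) (u : Fin (m + 2) → ℤ) : Prop where
  bucket : ∀ j, IsBucket j → 0 ≤ u j ∧ u j < n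
  inner : ∀ j, ¬ IsBucket j → u j = 0 ∨ u j = 1
  sum : (n : ℤ) ∣ ∑ j, u j

/-- The vertex set of the Yoke graph `Y(n, m)`. -/
abbrev YokeVertex (n m : ℕ) : Type :=
  {u : Fin (m + 2) → ℤ // IsYokeVertex n m u}

/-- `u` and `v` agree outside of the positions `i` and `i + 1`, and `u` is obtained from `v` by
shifting a unit between these two positions, to the left or to the right. -/
def IsUnitShift (n : ℕ) {m : ℕ} (i : Fin (m + 1)) (u v : Fin (m + 2) → ℤ) : Prop :=
  (∀ j, j ≠ i.castSucc → j ≠ i.succ → u j = v j) ∧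
    ((EntryEq n i.castSucc (u i.castSucc) (v i.castSucc + 1) ∧
        EntryEq n i.succ (u i.succ) (v i.succ - 1)) ∨
      (EntryEq n i.castSucc (u i.castSucc) (v i.castSucc - 1) ∧
        EntryEq n i.succ (u i.succ) (v i.succ + 1)))

theorem EntryEq.symm_sub {n m : ℕ} {j : Fin (m + 2)} {a b c : ℤ}
    (h : EntryEq n j a (b + c)) : EntryEq n j b (a - c) := by
  unfold EntryEq at h ⊢
  split_ifs at h ⊢
  · simpa using (h.sub_right c).symm
  · omega

theorem IsUnitShift.symm {n m : ℕ} {i : Fin (m + 1)} {u v : Fin (m + 2) → ℤ}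
    (h : IsUnitShift n i u v) : IsUnitShift n i v u := by
  obtain ⟨h0, h⟩ := h
  refine ⟨fun j h1 h2 => (h0 j h1 h2).symm, ?_⟩
  rcases h with ⟨h1, h2⟩ | ⟨h1, h2⟩
  · rw [sub_eq_add_neg] at h2
    exact Or.inr ⟨h1.symm_sub, by simpa using h2.symm_sub⟩
  · rw [sub_eq_add_neg] at h1
    exact Or.inl ⟨by simpa using h1.symm_sub, h2.symm_sub⟩

/-- The Yoke graph `Y(n, m)`. Like all graphs here it has no loops (the condition `u ≠ v` only
matters for `n = 1`, `m = 0`). -/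
def yokeGraph (n m : ℕ) : SimpleGraph (YokeVertex n m) where
  Adj u v := u ≠ v ∧ ∃ i : Fin (m + 1), IsUnitShift n i u.1 v.1
  symm := ⟨fun _ _ h => ⟨h.1.symm, h.2.imp fun _ hi => hi.symm⟩⟩
  loopless := ⟨fun _ h => h.1 rfl⟩

/-- The value `d₀ = C(⌊(m+n)/2⌋ + 1, 2) + C(⌈(m-n)/2⌉ + 1, 2)`, for `n ≤ m`.
Here `a / b` is the quotient rounded down and `a ⌈/⌉ b` the quotient rounded up. -/
def yokeD0 (n m : ℕ) : ℕ :=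
  ((m + n) / 2 + 1).choose 2 + ((m - n) ⌈/⌉ 2 + 1).choose 2

/-! Encode a vertex by its partial sums `a 0, …, a m`: a staircase, determined up to adding one
common multiple of `n`. An edge changes one partial sum by one, so the distance between `a` and `b`
is the minimum over `k` of `∑ |a i - b i + k * n|` (`edist_yokeOf_le`, `exists_sum_le_length`).
Differences of staircases are exactly the slow sequences, so the diameter is the max-min value in
`IsMaxMinSum`.

For the upper bound, a multiple of `n` at `z` can be shifted to zero, whence `|d i| ≤ |i - z|`; if a
block of positions avoids multiples, averaging two neighbouring shifts costs `n / 2` per position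
there. For `n ≤ m` the block is `t, …, s` with `s + t = m` and `s - t ∈ {n - 1, n}`. For the lower
bound, fixed sign patterns reduce all shifts to `k = 0` and `k = -1`. The extremal sequences are one
close to `n / 2` (`m ≤ n`), the identity, and the identity with a repeated term. -/

/-! ### Sums of distances and signs over a range -/

theorem two_mul_sum_range_tsub_left {t N : ℕ} (h : t ≤ N) :
    2 * ∑ i ∈ Finset.range N, (t - i) = t * (t + 1) := by
  induction t generalizing N with
  | zero => simp
  | succ t ih =>
    obtain ⟨N, rfl⟩ : ∃ k, N = k + 1 := ⟨N - 1, by omega⟩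
    rw [Finset.sum_range_succ', mul_add]
    simp only [Nat.add_sub_add_right, Nat.sub_zero]
    rw [ih (by omega)]
    ring

theorem two_mul_sum_range_tsub_right (s N : ℕ) :
    2 * ∑ i ∈ Finset.range N, (i - s) = (N - s) * (N - s - 1) := by
  induction N with
  | zero => simp
  | succ N ih =>
    rw [Finset.sum_range_succ, mul_add, ih]
    rcases Nat.lt_or_ge N s with h | h
    · simp [Nat.sub_eq_zero_of_le h.le, Nat.sub_eq_zero_of_le (Nat.succ_le_of_lt h)]
    · obtain ⟨c, rfl⟩ := Nat.exists_eq_add_of_le h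
      have h1 : s + c + 1 - s = c + 1 := by omega
      rw [h1, Nat.add_sub_cancel_left, Nat.add_sub_cancel]
      cases c with
      | zero => simp
      | succ c => simp only [Nat.add_sub_cancel]; ring

theorem two_mul_sum_range_abs_sub {a N : ℕ} (h : a ≤ N) :
    2 * ∑ i ∈ Finset.range N, |(i : ℤ) - a| = a * (a + 1) + (N - a) * (N - a - 1) := by
  have h1 := two_mul_sum_range_tsub_left h
  have h2 := two_mul_sum_range_tsub_right a N
  have h3 : ∑ i ∈ Finset.range N, |(i : ℤ) - a| =
      ((∑ i ∈ Finset.range N, (a - i) + ∑ i ∈ Finset.range N, (i - a) : ℕ) : ℤ) := by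
    rw [← Finset.sum_add_distrib, Nat.cast_sum]
    refine Finset.sum_congr rfl fun i _ => ?_
    rcases abs_cases ((i : ℤ) - a) with h | h <;> omega
  obtain ⟨c, rfl⟩ := Nat.exists_eq_add_of_le h
  rw [h3, Nat.cast_add, mul_add]
  rw [Nat.add_sub_cancel_left] at h2
  have h4 : ((c * (c - 1) : ℕ) : ℤ) = c * (c - 1) := by
    cases c with
    | zero => simp
    | succ c => simp
  rw [← h2] at h4
  zify at h1
  push_cast at *
  linear_combination h1 + h4

theorem sum_range_indicator_lt {a N : ℕ} (h : a ≤ N) :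
    ∑ i ∈ Finset.range N, (if i < a then (1 : ℤ) else 0) = a := by
  have h1 : (Finset.range N).filter (· < a) = Finset.range a := by
    ext i; simp only [Finset.mem_filter, Finset.mem_range]; omega
  rw [Finset.sum_boole, h1, Finset.card_range]

theorem sum_range_sign_lt {a N : ℕ} (h : a ≤ N) :
    ∑ i ∈ Finset.range N, (if i < a then (-1 : ℤ) else 1) = N - 2 * a := by
  have h1 : ∀ i ∈ Finset.range N, (if i < a then (-1 : ℤ) else 1) =
      1 - 2 * (if i < a then (1 : ℤ) else 0) := fun i _ => by split_ifs <;> norm_num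
  rw [Finset.sum_congr rfl h1, Finset.sum_sub_distrib, ← Finset.mul_sum, sum_range_indicator_lt h]
  simp

/-! ### Slow sequences: upper bounds -/

/-- Consecutive terms among `d 0, …, d m` differ by at most `1`. -/
def IsSlow (m : ℕ) (d : ℕ → ℤ) : Prop :=
  ∀ i < m, |d (i + 1) - d i| ≤ 1

theorem IsSlow.abs_sub_le {m : ℕ} {d : ℕ → ℤ} (hd : IsSlow m d) {i j : ℕ} (hi : i ≤ m)
    (hj : j ≤ m) : |d i - d j| ≤ |(i : ℤ) - j| := by
  have key : ∀ c i : ℕ, i + c ≤ m → |d (i + c) - d i| ≤ c := by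
    intro c i
    induction c with
    | zero => simp
    | succ c ih =>
      intro h
      have h1 := ih (by omega)
      have h2 := hd (i + c) (by omega)
      rw [← add_assoc]
      rw [abs_le] at *
      push_cast
      omega
  rcases le_total i j with h | h
  · obtain ⟨c, rfl⟩ := Nat.exists_eq_add_of_le h
    have := key c i hj
    rw [abs_sub_comm]
    refine this.trans ?_
    rw [abs_sub_comm]
    simp
  · obtain ⟨c, rfl⟩ := Nat.exists_eq_add_of_le h
    have := key c j hi
    refine this.trans ?_
    simp

theorem IsSlow.exists_sum_le_of_dvd {n m : ℕ} {d : ℕ → ℤ} (hd : IsSlow m d) {z : ℕ} (hz : z ≤ m)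
    (h : (n : ℤ) ∣ d z) :
    ∃ k : ℤ, 2 * ∑ i ∈ Finset.range (m + 1), |d i + k * n| ≤
      z * (z + 1) + (m - z) * (m - z + 1) := by
  obtain ⟨q, hq⟩ := h
  refine ⟨-q, ?_⟩
  have h1 := two_mul_sum_range_abs_sub (hz.trans (Nat.le_succ m))
  rw [show (z * (z + 1) + (m - z) * (m - z + 1) : ℤ) =
    z * (z + 1) + ((m.succ : ℕ) - z) * ((m.succ : ℕ) - z - 1) by push_cast; ring, ← h1]
  refine mul_le_mul_of_nonneg_left (Finset.sum_le_sum fun i hi => ?_) (by norm_num)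
  have := hd.abs_sub_le (i := i) (j := z) (by simpa [Nat.lt_succ_iff] using hi) hz
  rwa [show d i + -q * n = d i - d z by rw [hq]; ring]

/-- If no term in the positions `t, …, s` is divisible by `n`, then these terms lie between two
consecutive multiples of `n`, and one of these two multiples is close to the sequence. -/
theorem IsSlow.exists_sum_le_of_not_dvd {n m : ℕ} (hn : 1 ≤ n) {d : ℕ → ℤ} (hd : IsSlow m d)
    {t s : ℕ} (hts : t ≤ s) (hs : s ≤ m) (h : ∀ z, t ≤ z → z ≤ s → ¬ (n : ℤ) ∣ d z) :
    ∃ k : ℤ, 2 * ∑ i ∈ Finset.range (m + 1), |d i + k * n| ≤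
      n * (m + 1) + ((t * (t - 1) + (m - s) * (m - s - 1) : ℕ) : ℤ) := by
  obtain ⟨k, hk⟩ : ∃ k : ℤ, ∀ i, t ≤ i → i ≤ s → 0 < d i + k * n ∧ d i + k * n < n := by
    have hn0 : (0 : ℤ) < n := by exact_mod_cast hn
    refine ⟨-(d t / n), fun i hti => ?_⟩
    induction i, hti using Nat.le_induction with
    | base =>
      intro _
      have h1 := h t le_rfl hts
      rw [Int.dvd_iff_emod_eq_zero] at h1
      have h2 := Int.emod_nonneg (d t) hn0.ne'
      have h3 := Int.emod_lt_of_pos (d t) hn0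
      have h4 := Int.emod_add_mul_ediv (d t) n
      have h5 : d t + -(d t / n) * n = d t % n := by linear_combination -h4
      rw [h5]
      omega
    | succ i hi ih =>
      intro his
      obtain ⟨h1, h2⟩ := ih (by omega)
      have h3 := hd i (by omega)
      have h4 := h (i + 1) (by omega) his
      rw [abs_le] at h3
      constructor
      · refine lt_of_le_of_ne (by omega) fun h5 => h4 ⟨d t / n, by linear_combination -h5⟩
      · refine lt_of_le_of_ne (by omega) fun h5 => h4 ⟨d t / n + 1, by linear_combination h5⟩
  -- With `x = d i + k * n`, `|x| + |x - n|` equals `n` inside the block; outside, slowness allows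
  -- an excess of at most `2 * (t - 1 - i)` or `2 * (i - s - 1)`, as the block ends lie strictly
  -- between `0` and `n`.
  have hsum : ∑ i ∈ Finset.range (m + 1), (|d i + k * n| + |d i + (k - 1) * n|) ≤
      n * (m + 1) + ((t * (t - 1) + (m - s) * (m - s - 1) : ℕ) : ℤ) := by
    have h1 := two_mul_sum_range_tsub_left (t := t - 1) (N := m + 1) (by omega)
    have h2 := two_mul_sum_range_tsub_right (s + 1) (m + 1)
    have h3 : (t - 1) * (t - 1 + 1) = t * (t - 1) := by
      cases t with
      | zero => simp
      | succ t => rw [Nat.add_sub_cancel, mul_comm]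
    rw [Nat.add_sub_add_right] at h2
    rw [← h3, ← h1, ← h2, ← mul_add, ← Finset.sum_add_distrib]
    have h4 : (n * (m + 1) : ℤ) = ∑ i ∈ Finset.range (m + 1), (n : ℤ) := by
      simp [mul_comm]
    rw [h4, Nat.cast_mul, Nat.cast_sum, Finset.mul_sum, ← Finset.sum_add_distrib]
    refine Finset.sum_le_sum fun i hi => ?_
    rw [Finset.mem_range] at hi
    rw [show d i + (k - 1) * n = d i + k * n - n by ring]
    obtain ⟨ht1, ht2⟩ := hk t le_rfl hts
    obtain ⟨hs1, hs2⟩ := hk s hts le_rfl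
    have hit := hd.abs_sub_le (i := i) (j := t) (by omega) (by omega)
    have his := hd.abs_sub_le (i := i) (j := s) (by omega) (by omega)
    have hi' := hk i
    generalize k * (n : ℤ) = c at *
    clear h h1 h2 h3 h4 hk hd
    push_cast
    by_cases c1 : i < t
    · rw [abs_of_nonpos (by omega : (i : ℤ) - t ≤ 0), abs_le] at hit
      rcases abs_cases (d i + c) with h5 | h5 <;> rcases abs_cases (d i + c - n) with h6 | h6 <;>
        omega
    · by_cases c2 : s < i
      · rw [abs_of_nonneg (by omega : 0 ≤ (i : ℤ) - s), abs_le] at his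
        rcases abs_cases (d i + c) with h5 | h5 <;>
          rcases abs_cases (d i + c - n) with h6 | h6 <;> omega
      · have := hi' (by omega) (by omega)
        rcases abs_cases (d i + c) with h5 | h5 <;>
          rcases abs_cases (d i + c - n) with h6 | h6 <;> omega
  rw [Finset.sum_add_distrib] at hsum
  rcases le_total (∑ i ∈ Finset.range (m + 1), |d i + k * n|)
    (∑ i ∈ Finset.range (m + 1), |d i + (k - 1) * n|) with h1 | h1
  · exact ⟨k, by linarith⟩
  · exact ⟨k - 1, by linarith⟩

/-! ### Lower bounds and the max-min problem -/

/-- A sum of absolute values dominates any signed sum. With `c` minus signs, a shift by `x` changes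
the signed sum by `x * (N - 2 * c)`: `c = a` handles `k ≥ 0`, and `c = b`, starting from `d - n`,
handles `k ≤ -1`. -/
theorem le_sum_abs_add_mul {n N a b : ℕ} {d : ℕ → ℤ} {D : ℤ} (ha : 2 * a ≤ N) (hb : b ≤ N)
    (hb' : N ≤ 2 * b) (h1 : D ≤ ∑ i ∈ Finset.range N, if i < a then -d i else d i)
    (h2 : D ≤ ∑ i ∈ Finset.range N, if i < b then n - d i else d i - n) (k : ℤ) :
    D ≤ ∑ i ∈ Finset.range N, |d i + k * n| := by
  have key : ∀ (c : ℕ) (x : ℤ), c ≤ N → 0 ≤ x * ((N : ℤ) - 2 * c) → ∀ e : ℕ → ℤ,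
      (∑ i ∈ Finset.range N, if i < c then -e i else e i) ≤
        ∑ i ∈ Finset.range N, |e i + x| := by
    intro c x hc hx e
    rw [← sum_range_sign_lt hc, Finset.mul_sum] at hx
    refine (le_add_of_nonneg_right hx).trans ?_
    rw [← Finset.sum_add_distrib]
    refine Finset.sum_le_sum fun i _ => ?_
    split_ifs
    · have := neg_le_abs (e i + x)
      linarith
    · have := le_abs_self (e i + x)
      linarith
  have hn0 : (0 : ℤ) ≤ n := by positivity
  rcases le_or_gt 0 k with hk | hk
  · refine h1.trans (key a (k * n) (by omega) ?_ d)
    exact mul_nonneg (by positivity) (by omega)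
  · refine h2.trans ?_
    have := key b ((k + 1) * n) hb
      (mul_nonneg_of_nonpos_of_nonpos (mul_nonpos_of_nonpos_of_nonneg (by omega) hn0) (by omega))
      (fun i => d i - n)
    refine le_of_eq_of_le (Finset.sum_congr rfl fun i _ => ?_)
      (this.trans_eq (Finset.sum_congr rfl fun i _ => ?_))
    · split_ifs <;> ring
    · congr 1; ring

/-- `D` is the maximum over all slow `d` of the minimum over `k` of `∑ |d i + k * n|`. -/
structure IsMaxMinSum (n m D : ℕ) : Prop where
  le : ∀ d, IsSlow m d → ∃ k : ℤ, ∑ i ∈ Finset.range (m + 1), |d i + k * n| ≤ D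
  ge : ∃ d, IsSlow m d ∧ ∀ k : ℤ, D ≤ ∑ i ∈ Finset.range (m + 1), |d i + k * n|

theorem isMaxMinSum_of_le {n m : ℕ} (hn : 1 ≤ n) (hmn : m ≤ n) :
    IsMaxMinSum n m (n * (m + 1) / 2) where
  le d hd := by
    have hD : (((n * (m + 1) / 2 : ℕ) : ℕ) : ℤ) = (n * (m + 1) : ℤ) / 2 := by push_cast; rfl
    rw [hD]
    by_cases h : ∃ z ≤ m, (n : ℤ) ∣ d z
    · obtain ⟨z, hz, h⟩ := h
      obtain ⟨k, hk⟩ := hd.exists_sum_le_of_dvd hz h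
      refine ⟨k, ?_⟩
      have h1 : (z * (z + 1) + (m - z) * (m - z + 1) : ℤ) ≤ n * (m + 1) := by
        have h2 : (0 : ℤ) ≤ z * (m - z) := mul_nonneg (by positivity) (by omega)
        have h3 : (m * (m + 1) : ℤ) ≤ n * (m + 1) := by
          exact_mod_cast Nat.mul_le_mul_right _ hmn
        linarith
      omega
    · push Not at h
      obtain ⟨k, hk⟩ := hd.exists_sum_le_of_not_dvd hn (Nat.zero_le m) le_rfl
        (fun z _ hz => h z hz)
      refine ⟨k, ?_⟩
      simp only [Nat.sub_self, Nat.zero_mul, Nat.cast_zero, add_zero] at hk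
      omega
  ge := by
    -- Each term is `n / 2` rounded down or up; telescoping makes the total exactly `⌊n (m + 1) /
    -- 2⌋`.
    let d : ℕ → ℤ := fun i => ((n * (i + 1) : ℕ) : ℤ) / 2 - ((n * i : ℕ) : ℤ) / 2
    have hsum : ∑ i ∈ Finset.range (m + 1), d i = ((n * (m + 1) / 2 : ℕ) : ℤ) := by
      rw [Finset.sum_range_sub (fun i : ℕ => ((n * i : ℕ) : ℤ) / 2)]
      simp
    refine ⟨d, fun i _ => ?_, le_sum_abs_add_mul (a := 0) (b := m + 1) (by omega) le_rfl (by omega)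
      ?_ ?_⟩
    · simp only [d, Nat.mul_add]
      rw [abs_le]
      omega
    · simpa using hsum.ge
    · have h1 : ∀ i ∈ Finset.range (m + 1),
          (if i < m + 1 then (n : ℤ) - d i else d i - n) = n - d i := fun i hi => by
        rw [if_pos (Finset.mem_range.1 hi)]
      rw [Finset.sum_congr rfl h1, Finset.sum_sub_distrib, hsum]
      simp only [Finset.sum_const, Finset.card_range, nsmul_eq_mul]
      have : ((m + 1 : ℕ) : ℤ) * n = ((n * (m + 1) : ℕ) : ℤ) := by push_cast; ring
      rw [this]
      omega

theorem two_mul_choose_succ_two (x : ℕ) : 2 * (x + 1).choose 2 = x * (x + 1) := by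
  rw [Nat.choose_two_right, Nat.add_sub_cancel, mul_comm (x + 1) x]
  exact Nat.mul_div_cancel' (Nat.even_mul_succ_self x).two_dvd

/-- The upper bound, for `m = s + t` with `s - t ∈ {n - 1, n}`. -/
theorem IsSlow.exists_sum_le_max {n s t : ℕ} (hn : 1 ≤ n) (hst : t ≤ s) {d : ℕ → ℤ}
    (hd : IsSlow (s + t) d) : ∃ k : ℤ, 2 * ∑ i ∈ Finset.range (s + t + 1), |d i + k * n| ≤
      max (s * (s + 1) + t * (t + 1) : ℤ) (n * (s + t + 1) + 2 * (t * (t - 1))) := by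
  by_cases h : ∃ z, t ≤ z ∧ z ≤ s ∧ (n : ℤ) ∣ d z
  · obtain ⟨z, hz1, hz2, h⟩ := h
    obtain ⟨k, hk⟩ := hd.exists_sum_le_of_dvd (by omega) h
    refine ⟨k, hk.trans (le_max_of_le_left ?_)⟩
    push_cast
    -- By convexity in `z`, the bound is worst at the ends `z = t` and `z = s`.
    have : (0 : ℤ) ≤ (z - t) * (s - z) := mul_nonneg (by omega) (by omega)
    linarith
  · push Not at h
    obtain ⟨k, hk⟩ := hd.exists_sum_le_of_not_dvd hn hst (by omega) h
    refine ⟨k, hk.trans (le_max_of_le_right ?_)⟩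
    rw [Nat.add_sub_cancel_left]
    cases t with
    | zero => simp
    | succ t => simp only [Nat.add_sub_cancel]; push_cast; linarith

/-- The identity sequence, shifted to vanish at `t`, is extremal. -/
theorem exists_isSlow_le_sum {n s t : ℕ} (hn : 1 ≤ n) (h1 : t ≤ s) (h2 : s ≤ t + n) (h3 : n ≤ s + 1) :
    ∃ d, IsSlow (s + t) d ∧ ∀ k : ℤ, (((s + 1).choose 2 + (t + 1).choose 2 : ℕ) : ℤ) ≤
      ∑ i ∈ Finset.range (s + t + 1), |d i + k * n| := by
  have hs := two_mul_choose_succ_two s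
  have ht := two_mul_choose_succ_two t
  zify at hs ht
  have key : ∀ a : ℕ, a ≤ s + t + 1 → (a = t ∨ s ≤ a) →
      (((s + 1).choose 2 + (t + 1).choose 2 : ℕ) : ℤ) ≤
        ∑ i ∈ Finset.range (s + t + 1), |(i : ℤ) - a| := by
    intro a ha h
    have h4 := two_mul_sum_range_abs_sub ha
    have h5 : (0 : ℤ) ≤ (a - t) * (a - s) := by
      rcases h with rfl | h
      · simp
      · exact mul_nonneg (by omega) (by omega)
    push_cast at h4 ⊢
    linarith
  refine ⟨fun i => i - t, fun i _ => by push_cast; rw [abs_le]; omega,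
    le_sum_abs_add_mul (a := t) (b := t + n) (by omega) (by omega) (by omega)
      ((key t (by omega) (Or.inl rfl)).trans_eq (Finset.sum_congr rfl fun i _ => ?_))
      ((key (t + n) (by omega) (Or.inr h2)).trans_eq (Finset.sum_congr rfl fun i _ => ?_))⟩
  · rcases abs_cases ((i : ℤ) - t) with h | h <;> split_ifs <;> omega
  · rcases abs_cases ((i : ℤ) - (t + n : ℕ)) with h | h <;> split_ifs <;> omega

/-- The identity sequence with one repeated term halfway between two multiples of `n`. -/
theorem exists_isSlow_le_sum_of_repeat {n t : ℕ} (hn : 2 ≤ n) :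
    ∃ d, IsSlow (n + t - 1 + t) d ∧ ∀ k : ℤ, ((n * (n + 2 * t) / 2 : ℕ) + t * (t - 1) : ℤ) ≤
      ∑ i ∈ Finset.range (n + t - 1 + t + 1), |d i + k * n| := by
  rw [show n + t - 1 + t + 1 = n + t + t by omega]
  have hq' : ((n * (n + 2 * t) / 2 : ℕ) : ℤ) =
      ((n * (n - 1) / 2 : ℕ) : ℤ) + n / 2 + n * t := by
    have h1 : n * (n + 2 * t) = n * (n - 1) + n + 2 * (n * t) := by
      obtain ⟨c, rfl⟩ := Nat.exists_eq_add_of_le hn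
      rw [show 2 + c - 1 = c + 1 by omega]
      ring
    have h2 := (Nat.even_mul_pred_self n).two_dvd
    rw [h1]
    push_cast
    omega
  have hp : 2 * ((n * (n - 1) / 2 : ℕ) : ℤ) = n * (n - 1) := by
    have h2 := Nat.mul_div_cancel' (Nat.even_mul_pred_self n).two_dvd
    rw [← Nat.cast_pred (by omega : 0 < n)]
    exact_mod_cast h2
  generalize ((n * (n - 1) / 2 : ℕ) : ℤ) = p at hq' hp
  have hI := sum_range_indicator_lt (a := t + n / 2) (N := n + t + t) (by omega)
  have hJ := sum_range_indicator_lt (a := t) (N := n + t + t) (by omega)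
  have hA := two_mul_sum_range_abs_sub (a := t) (N := n + t + t) (by omega)
  have hB := two_mul_sum_range_abs_sub (a := n + t) (N := n + t + t) (by omega)
  have h1 : ∑ i ∈ Finset.range (n + t + t),
      (if i < t then -(if i < t + n / 2 then (i : ℤ) - t + 1 else i - t)
        else (if i < t + n / 2 then (i : ℤ) - t + 1 else i - t)) =
      ∑ i ∈ Finset.range (n + t + t), |(i : ℤ) - t| + (t + n / 2 : ℕ) - 2 * t := by
    have hJ' : (2 * t : ℤ) = ∑ i ∈ Finset.range (n + t + t), 2 * (if i < t then (1 : ℤ) else 0) := by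
      rw [← Finset.mul_sum, hJ]
    rw [← hI, hJ', ← Finset.sum_add_distrib, ← Finset.sum_sub_distrib]
    refine Finset.sum_congr rfl fun i _ => ?_
    rcases abs_cases ((i : ℤ) - t) with h | h <;> split_ifs <;> omega
  have h2 : ∑ i ∈ Finset.range (n + t + t),
      (if i < n + t then n - (if i < t + n / 2 then (i : ℤ) - t + 1 else i - t)
        else (if i < t + n / 2 then (i : ℤ) - t + 1 else i - t) - n) =
      ∑ i ∈ Finset.range (n + t + t), |(i : ℤ) - (n + t : ℕ)| - (t + n / 2 : ℕ) := by
    rw [← hI, ← Finset.sum_sub_distrib]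
    refine Finset.sum_congr rfl fun i _ => ?_
    rcases abs_cases ((i : ℤ) - (n + t : ℕ)) with h | h <;> split_ifs <;> omega
  -- The value `n / 2` occurs twice, so positions `t, …, n + t - 1` carry only `1, …, n - 1` and
  -- avoid multiples of `n`.
  refine ⟨fun i => if i < t + n / 2 then i - t + 1 else i - t, fun i _ => ?_,
    le_sum_abs_add_mul (a := t) (b := n + t) (by omega) (by omega) (by omega)
      (le_of_le_of_eq ?_ h1.symm) (le_of_le_of_eq ?_ h2.symm)⟩
  · rw [abs_le]
    push_cast
    split_ifs <;> omega
  · rw [hq']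
    push_cast at hA ⊢
    linarith
  · have h3 : (0 : ℤ) ≤ n - 2 * (n / 2) := by omega
    rw [hq']
    push_cast at hB ⊢
    linarith

theorem isMaxMinSum_of_eq_add {n t : ℕ} (hn : 1 ≤ n) :
    IsMaxMinSum n (n + t + t) ((n + t + 1).choose 2 + (t + 1).choose 2) where
  le d hd := by
    obtain ⟨k, hk⟩ := hd.exists_sum_le_max hn (by omega)
    refine ⟨k, ?_⟩
    have hs := two_mul_choose_succ_two (n + t)
    have ht := two_mul_choose_succ_two t
    zify at hs ht
    rw [max_eq_left (by push_cast; linarith)] at hk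
    push_cast at hk ⊢
    linarith
  ge := exists_isSlow_le_sum hn (by omega) (by omega) (by omega)

/-- After halving and rounding down, the two bounds of `IsSlow.exists_sum_le_max` differ by `n / 2 -
t`. Its sign decides whether the identity or the repeated-term sequence is extremal; truncated
subtraction merges the cases. -/
theorem isMaxMinSum_of_eq_add_sub_one {n t : ℕ} (hn : 1 ≤ n) (ht : 1 ≤ t) :
    IsMaxMinSum n (n + t - 1 + t)
      ((n + t - 1 + 1).choose 2 + (t + 1).choose 2 + (n / 2 - t)) := by
  have hD : (((n + t - 1 + 1).choose 2 + (t + 1).choose 2 : ℕ) : ℤ) + (n / 2 - t) =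
      (n * (n + 2 * t) / 2 : ℕ) + t * (t - 1) := by
    have h1 := two_mul_choose_succ_two (n + t - 1)
    have h2 := two_mul_choose_succ_two t
    zify [show 1 ≤ n + t by omega] at h1 h2
    have h3 : ((n * (n + 2 * t) : ℕ) : ℤ) = 2 * ((n + t - 1 + 1).choose 2 +
        (t + 1).choose 2 - t * t : ℤ) + n := by
      push_cast
      linarith
    have h4 : (t * (t - 1) : ℤ) = t * t - t := by ring
    rw [h4]
    push_cast at h3 ⊢
    rw [h3]
    generalize (t * t : ℤ) = y
    omega
  constructor
  · intro d hd
    obtain ⟨k, hk⟩ := hd.exists_sum_le_max hn (by omega)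
    refine ⟨k, ?_⟩
    have h1 := two_mul_choose_succ_two (n + t - 1)
    have h2 := two_mul_choose_succ_two t
    zify at h1 h2
    rcases le_max_iff.1 hk with h3 | h3
    · push_cast at h1 h2 ⊢
      omega
    · have h4 : (n * (((n + t - 1 : ℕ) : ℤ) + t + 1) : ℤ) = (n * (n + 2 * t) : ℕ) := by
        push_cast [show 1 ≤ n + t by omega]
        ring
      rw [h4] at h3
      generalize (t * (t - 1) : ℤ) = y at *
      omega
  · rcases le_or_gt (n / 2) t with h | h
    · rw [Nat.sub_eq_zero_of_le h, add_zero]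
      exact exists_isSlow_le_sum hn (by omega) (by omega) (by omega)
    · obtain ⟨d, hd, h5⟩ := exists_isSlow_le_sum_of_repeat (n := n) (t := t) (by omega)
      refine ⟨d, hd, fun k => le_of_eq_of_le ?_ (h5 k)⟩
      rw [← hD]
      push_cast [h.le]
      ring

theorem isMaxMinSum_of_ge {n m : ℕ} (hn : 1 ≤ n) (hmn : n ≤ m) :
    IsMaxMinSum n m
      (yokeD0 n m + if 2 ∣ m - n ∨ n ≤ (m + 1) ⌈/⌉ 2 then 0 else n - (m + 1) ⌈/⌉ 2) := by
  unfold yokeD0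
  simp only [Nat.ceilDiv_eq_add_pred_div]
  by_cases h : 2 ∣ m - n
  · obtain ⟨t, ht⟩ := h
    obtain rfl : m = n + t + t := by omega
    rw [if_pos (Or.inl ⟨t, ht⟩), show (n + t + t + n) / 2 = n + t by omega,
      show (n + t + t - n + 2 - 1) / 2 = t by omega]
    exact isMaxMinSum_of_eq_add hn
  · obtain ⟨t, ht⟩ : ∃ t, m - n = 2 * t + 1 := ⟨(m - n) / 2, by omega⟩
    obtain rfl : m = n + (t + 1) - 1 + (t + 1) := by omega
    have h1 := isMaxMinSum_of_eq_add_sub_one hn (Nat.le_add_left 1 t)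
    convert h1 using 2
    · congr 3 <;> omega
    -- Here `m + 1 = n + 2 * (t + 1)`, so `n - ⌈(m + 1) / 2⌉` is `n / 2 - (t + 1)`.
    · split_ifs <;> omega

/-! ### Vertices as staircases of partial sums -/

/-- The increments of `a 0, …, a m` are `0` or `1`. -/
def IsStaircase (m : ℕ) (a : ℕ → ℤ) : Prop :=
  ∀ i < m, a (i + 1) - a i = 0 ∨ a (i + 1) - a i = 1

/-- The entries of the vertex whose partial sums are `a 0, …, a m`, modulo `n`. -/
def yokeEntry (n m : ℕ) (a : ℕ → ℤ) (j : ℕ) : ℤ :=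
  if j = 0 then a 0 % n else if j = m + 1 then -a m % n else a j - a (j - 1)

theorem yokeEntry_zero (n m : ℕ) (a : ℕ → ℤ) : yokeEntry n m a 0 = a 0 % n := if_pos rfl

theorem yokeEntry_last (n m : ℕ) (a : ℕ → ℤ) : yokeEntry n m a (m + 1) = -a m % n := by
  simp [yokeEntry]

theorem yokeEntry_succ (n : ℕ) {m : ℕ} (a : ℕ → ℤ) {j : ℕ} (hj : j < m) :
    yokeEntry n m a (j + 1) = a (j + 1) - a j := by
  simp [yokeEntry, hj.ne]

theorem isBucket_iff {m : ℕ} {j : Fin (m + 2)} : IsBucket j ↔ j.val = 0 ∨ j.val = m + 1 :=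
  or_congr Fin.ext_iff Fin.ext_iff

theorem entryEq_of_isBucket {n m : ℕ} {j : Fin (m + 2)} {a b : ℤ} (hj : IsBucket j) :
    EntryEq n j a b ↔ a ≡ b [ZMOD n] := by
  simp [EntryEq, hj]

theorem entryEq_of_not_isBucket {n m : ℕ} {j : Fin (m + 2)} {a b : ℤ} (hj : ¬ IsBucket j) :
    EntryEq n j a b ↔ a = b := by
  simp [EntryEq, hj]

theorem IsStaircase.isYokeVertex {n m : ℕ} (hn : 1 ≤ n) {a : ℕ → ℤ} (ha : IsStaircase m a) :
    IsYokeVertex n m (fun j => yokeEntry n m a j) where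
  bucket j hj := by
    have hn0 : (0 : ℤ) < n := by exact_mod_cast hn
    rcases isBucket_iff.1 hj with h | h <;> rw [h]
    · rw [yokeEntry_zero]
      exact ⟨Int.emod_nonneg _ hn0.ne', Int.emod_lt_of_pos _ hn0⟩
    · rw [yokeEntry_last]
      exact ⟨Int.emod_nonneg _ hn0.ne', Int.emod_lt_of_pos _ hn0⟩
  inner j hj := by
    rw [isBucket_iff] at hj
    obtain ⟨i, hi⟩ : ∃ i, j.val = i + 1 := ⟨j.val - 1, by omega⟩
    have him : i < m := by omega
    rw [hi, yokeEntry_succ n a him]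
    exact ha i him
  sum := by
    rw [Fin.sum_univ_eq_sum_range (fun j => yokeEntry n m a j) (m + 2), Finset.sum_range_succ,
      Finset.sum_range_succ', yokeEntry_zero, yokeEntry_last,
      Finset.sum_congr rfl fun j hj => yokeEntry_succ n a (Finset.mem_range.1 hj),
      Finset.sum_range_sub]
    have h1 := Int.emod_add_mul_ediv (a 0) n
    have h2 := Int.emod_add_mul_ediv (-a m) n
    exact ⟨-(a 0 / n) - (-a m / n), by linear_combination h1 + h2⟩

/-- The vertex of the Yoke graph whose partial sums are `a 0, …, a m`, modulo `n`. -/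
def yokeOf {n m : ℕ} (hn : 1 ≤ n) (a : ℕ → ℤ) (ha : IsStaircase m a) : YokeVertex n m :=
  ⟨fun j => yokeEntry n m a j, ha.isYokeVertex hn⟩

theorem exists_eq_yokeOf {n m : ℕ} (hn : 1 ≤ n) (u : YokeVertex n m) :
    ∃ (a : ℕ → ℤ) (ha : IsStaircase m a), u = yokeOf hn a ha := by
  obtain ⟨u, hu⟩ := u
  let e : ℕ → ℤ := fun j => if h : j < m + 2 then u ⟨j, h⟩ else 0
  have he : ∀ j : Fin (m + 2), e j = u j := fun j => by simp [e]
  have hstep : ∀ i, (∑ j ∈ Finset.range (i + 1 + 1), e j) - ∑ j ∈ Finset.range (i + 1), e j =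
      e (i + 1) := fun i => by rw [Finset.sum_range_succ _ (i + 1), add_sub_cancel_left]
  refine ⟨fun i => ∑ j ∈ Finset.range (i + 1), e j, fun i hi => ?_, Subtype.ext (funext fun j => ?_)⟩
  · rw [hstep]
    have h1 := hu.inner ⟨i + 1, by omega⟩ (by rw [isBucket_iff]; simp; omega)
    rwa [← he] at h1
  · change u j = yokeEntry n m (fun i => ∑ j ∈ Finset.range (i + 1), e j) j
    rw [← he]
    obtain ⟨j, hj⟩ := j
    rcases Nat.eq_zero_or_pos j with rfl | hj0
    · have h1 := hu.bucket 0 (Or.inl rfl)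
      rw [← he] at h1
      rw [yokeEntry_zero]
      simpa using (Int.emod_eq_of_lt h1.1 h1.2).symm
    · obtain ⟨i, rfl⟩ : ∃ i, j = i + 1 := ⟨j - 1, by omega⟩
      rcases Nat.lt_or_ge i m with him | him
      · rw [yokeEntry_succ n _ him]
        exact (hstep i).symm
      · obtain rfl : i = m := by omega
        have h1 := hu.bucket (Fin.last (i + 1)) (Or.inr rfl)
        rw [← he] at h1
        rw [yokeEntry_last]
        have h2 := hu.sum
        rw [← Finset.sum_congr rfl fun j _ => he j,
          Fin.sum_univ_eq_sum_range e (i + 2), Finset.sum_range_succ] at h2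
        simp only [Fin.val_last] at h1
        have h3 : -(∑ j ∈ Finset.range (i + 1), e j) ≡ e (i + 1) [ZMOD n] := by
          rw [Int.modEq_iff_dvd, sub_neg_eq_add, add_comm]
          exact h2
        rw [h3, Int.emod_eq_of_lt h1.1 h1.2]

theorem yokeOf_eq_of_add_mul {n m : ℕ} (hn : 1 ≤ n) {a b : ℕ → ℤ} (ha : IsStaircase m a)
    (hb : IsStaircase m b) {k : ℤ} (h : ∀ i ≤ m, b i = a i + k * n) :
    yokeOf hn a ha = yokeOf hn b hb := by
  refine Subtype.ext (funext fun j => ?_)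
  change yokeEntry n m a j = yokeEntry n m b j
  unfold yokeEntry
  split_ifs with h0 h1
  · rw [h 0 (Nat.zero_le m), Int.add_mul_emod_self_right]
  · rw [h m le_rfl, neg_add, ← neg_mul, Int.add_mul_emod_self_right]
  · rw [h j (by omega), h (j - 1) (by omega)]
    ring

theorem isUnitShift_yokeOf {n m : ℕ} (hn : 1 ≤ n) {a b : ℕ → ℤ} (ha : IsStaircase m a)
    (hb : IsStaircase m b) {i : ℕ} (hi : i ≤ m) (hi' : b i = a i + 1)
    (h : ∀ j ≤ m, j ≠ i → b j = a j) :
    IsUnitShift n ⟨i, Nat.lt_succ_of_le hi⟩ (yokeOf hn a ha).1 (yokeOf hn b hb).1 := by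
  refine ⟨fun j h1 h2 => ?_, Or.inr ⟨?_, ?_⟩⟩
  · change yokeEntry n m a j = yokeEntry n m b j
    simp only [ne_eq, Fin.ext_iff, Fin.val_castSucc, Fin.val_succ] at h1 h2
    unfold yokeEntry
    split_ifs with h3 h4
    · rw [h 0 (by omega) (by omega)]
    · rw [h m (by omega) (by omega)]
    · rw [h j (by omega) (by omega), h (j - 1) (by omega) (by omega)]
  · change EntryEq n _ (yokeEntry n m a i) (yokeEntry n m b i - 1)
    rcases Nat.eq_zero_or_pos i with rfl | h0
    · rw [entryEq_of_isBucket (by exact Or.inl rfl), yokeEntry_zero, yokeEntry_zero, hi']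
      refine (Int.mod_modEq _ _).trans ?_
      simpa using ((Int.mod_modEq (a 0 + 1) n).sub_right 1).symm
    · rw [entryEq_of_not_isBucket (by rw [isBucket_iff]; simp; omega)]
      obtain ⟨j, rfl⟩ : ∃ j, i = j + 1 := ⟨i - 1, by omega⟩
      rw [yokeEntry_succ n a hi, yokeEntry_succ n b hi, hi', h j (by omega) (by omega)]
      ring
  · change EntryEq n _ (yokeEntry n m a (i + 1)) (yokeEntry n m b (i + 1) + 1)
    rcases Nat.lt_or_eq_of_le hi with him | rfl
    · rw [entryEq_of_not_isBucket (by rw [isBucket_iff]; simp; omega)]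
      rw [yokeEntry_succ n a him, yokeEntry_succ n b him, hi', h (i + 1) him (by omega)]
      ring
    · rw [entryEq_of_isBucket (by exact Or.inr rfl), yokeEntry_last, yokeEntry_last, hi']
      refine (Int.mod_modEq _ _).trans ?_
      simpa using ((Int.mod_modEq (-(a i + 1)) n).add_right 1).symm

/-! ### Graph distance in terms of partial sums -/

theorem edist_le_one_of_isUnitShift {n m : ℕ} {u v : YokeVertex n m} {i : Fin (m + 1)}
    (h : IsUnitShift n i u.1 v.1) : (yokeGraph n m).edist u v ≤ 1 := by
  rcases eq_or_ne u v with rfl | huv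
  · simp
  · have h1 : (yokeGraph n m).Adj u v := ⟨huv, i, h⟩
    simpa using SimpleGraph.edist_le h1.toWalk

/-- If `a` lies below `b` somewhere, then `a` can be raised towards `b` at some position. -/
theorem IsStaircase.exists_raise {m : ℕ} {a b : ℕ → ℤ} (ha : IsStaircase m a)
    (hb : IsStaircase m b) (h : ∃ i ≤ m, a i < b i) :
    ∃ i ≤ m, a i < b i ∧ IsStaircase m (Function.update a i (a i + 1)) := by
  obtain ⟨i₀, hi₀, h⟩ := h
  obtain ⟨i, hi, hmin⟩ := Finset.exists_min_image
    ((Finset.range (m + 1)).filter fun i => a i < b i) (fun i => 2 * a i - i)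
    ⟨i₀, by simp only [Finset.mem_filter, Finset.mem_range]; exact ⟨by omega, h⟩⟩
  simp only [Finset.mem_filter, Finset.mem_range] at hi hmin
  refine ⟨i, by omega, hi.2, fun j hj => ?_⟩
  -- Raising fails only if `a` is flat just after `i` or rises just before it. Either neighbour
  -- would still lie below `b` and have `2 * a i - i` smaller by one, against minimality.
  have haj := ha j hj
  have hbj := hb j hj
  rcases eq_or_ne j i with rfl | h1
  · have := hmin (j + 1)
    rw [Function.update_self, Function.update_of_ne (by omega)]
    push_cast at this
    omega
  · rcases eq_or_ne (j + 1) i with rfl | h2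
    · have := hmin j
      rw [Function.update_self, Function.update_of_ne (by omega)]
      push_cast at this
      omega
    · rwa [Function.update_of_ne h1, Function.update_of_ne h2]

theorem edist_yokeOf_le {n m : ℕ} (hn : 1 ≤ n) (N : ℕ) : ∀ {a b : ℕ → ℤ} (ha : IsStaircase m a)
    (hb : IsStaircase m b), ∑ i ∈ Finset.range (m + 1), |a i - b i| ≤ N →
    (yokeGraph n m).edist (yokeOf hn a ha) (yokeOf hn b hb) ≤ N := by
  induction N with
  | zero =>
    intro a b ha hb h
    have h1 : ∀ i ∈ Finset.range (m + 1), |a i - b i| = 0 :=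
      (Finset.sum_eq_zero_iff_of_nonneg fun i _ => abs_nonneg _).1
        (le_antisymm h (Finset.sum_nonneg fun i _ => abs_nonneg _))
    rw [yokeOf_eq_of_add_mul hn ha hb (k := 0) fun i hi => ?_]
    · simp
    · have := h1 i (Finset.mem_range.2 (by omega))
      rw [abs_eq_zero] at this
      linarith
  | succ N ih =>
    have key : ∀ {a b : ℕ → ℤ} (ha : IsStaircase m a) (hb : IsStaircase m b),
        ∑ i ∈ Finset.range (m + 1), |a i - b i| ≤ (N + 1 : ℕ) → (∃ i ≤ m, a i < b i) →
        (yokeGraph n m).edist (yokeOf hn a ha) (yokeOf hn b hb) ≤ (N + 1 : ℕ) := by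
      intro a b ha hb h hlt
      obtain ⟨i, hi, hab, hc⟩ := ha.exists_raise hb hlt
      have h1 := edist_le_one_of_isUnitShift (isUnitShift_yokeOf hn ha hc hi (by simp)
        fun j _ hj => Function.update_of_ne hj _ _)
      refine SimpleGraph.edist_triangle.trans ((add_le_add h1 (ih hc hb ?_)).trans_eq ?_)
      · have h2 : ∑ j ∈ Finset.range (m + 1), |Function.update a i (a i + 1) j - b j| + 1 ≤
            ∑ j ∈ Finset.range (m + 1), |a j - b j| := by
          have h3 : (1 : ℤ) = ∑ j ∈ Finset.range (m + 1), if j = i then 1 else 0 := by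
            rw [Finset.sum_ite_eq', if_pos (Finset.mem_range.2 (by omega))]
          rw [h3, ← Finset.sum_add_distrib]
          refine Finset.sum_le_sum fun j _ => ?_
          rcases eq_or_ne j i with rfl | hj
          · rw [Function.update_self, if_pos rfl, abs_of_neg (sub_neg.2 hab),
              abs_of_nonpos (by omega)]
            omega
          · rw [Function.update_of_ne hj, if_neg hj, add_zero]
        push_cast at h
        linarith
      · push_cast
        ring
    intro a b ha hb h
    by_cases h1 : ∃ i ≤ m, a i < b i
    · exact key ha hb h h1
    · by_cases h2 : ∃ i ≤ m, b i < a i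
      · rw [SimpleGraph.edist_comm]
        exact key hb ha (by simpa only [abs_sub_comm] using h) h2
      · push Not at h1 h2
        rw [yokeOf_eq_of_add_mul hn ha hb (k := 0) fun i hi => ?_]
        · simp
        · have := h1 i hi
          have := h2 i hi
          linarith

/-- The first bucket fixes the common multiple of `n`; comparing later entries propagates it,
leaving a deviation of `±1` only at the position of the shift. -/
theorem exists_sub_eq_of_adj {n m : ℕ} (hn : 1 ≤ n) {a b : ℕ → ℤ} {ha : IsStaircase m a}
    {hb : IsStaircase m b} (h : (yokeGraph n m).Adj (yokeOf hn a ha) (yokeOf hn b hb)) :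
    ∃ k : ℤ, ∑ i ∈ Finset.range (m + 1), |a i - b i + k * n| ≤ 1 := by
  obtain ⟨-, i, h0, h⟩ := h
  obtain ⟨σ, hσ, h1, h2⟩ : ∃ σ : ℤ, |σ| = 1 ∧
      EntryEq n i.castSucc (yokeEntry n m a i) (yokeEntry n m b i + σ) ∧
      EntryEq n i.succ (yokeEntry n m a (i + 1)) (yokeEntry n m b (i + 1) - σ) := by
    rcases h with ⟨h1, h2⟩ | ⟨h1, h2⟩
    · exact ⟨1, by simp, h1, h2⟩
    · exact ⟨-1, by simp, h1, by rwa [sub_neg_eq_add]⟩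
  have h3 : ∀ j (hj : j < m + 2), j ≠ i → j ≠ i + 1 → yokeEntry n m a j = yokeEntry n m b j :=
    fun j hj hj1 hj2 => h0 ⟨j, hj⟩ (by simpa [Fin.ext_iff] using hj1)
      (by simpa [Fin.ext_iff] using hj2)
  clear h h0
  obtain ⟨i, hi⟩ := i
  dsimp only at *
  obtain ⟨k, hk⟩ : ∃ k : ℤ, a 0 - b 0 = (if 0 = i then σ else 0) + n * k := by
    rcases Nat.eq_zero_or_pos i with rfl | hi0
    · rw [entryEq_of_isBucket (by exact Or.inl rfl), yokeEntry_zero, yokeEntry_zero] at h1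
      have h4 := ((Int.mod_modEq (a 0) n).symm.trans h1).trans
        ((Int.mod_modEq (b 0) n).add_right σ)
      obtain ⟨k, hk⟩ := h4.symm.dvd
      exact ⟨k, by rw [if_pos rfl]; linear_combination hk⟩
    · have h4 := h3 0 (by omega) (by omega) (by omega)
      rw [yokeEntry_zero, yokeEntry_zero] at h4
      obtain ⟨k, hk⟩ := Int.ModEq.dvd (show b 0 ≡ a 0 [ZMOD n] from h4.symm)
      exact ⟨k, by rw [if_neg (by omega)]; linear_combination hk⟩
  have key : ∀ j ≤ m, a j - b j = (if j = i then σ else 0) + n * k := by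
    intro j
    induction j with
    | zero => intro _; exact hk
    | succ j ih =>
      intro hj
      have h4 := ih (by omega)
      rcases eq_or_ne (j + 1) i with rfl | hji
      · rw [entryEq_of_not_isBucket (by rw [isBucket_iff]; simp; omega), yokeEntry_succ n a hj,
          yokeEntry_succ n b hj] at h1
        rw [if_neg (by omega)] at h4
        rw [if_pos rfl]
        linear_combination h4 + h1
      · rw [if_neg hji]
        rcases eq_or_ne j i with rfl | hji'
        · rw [entryEq_of_not_isBucket (by rw [isBucket_iff]; simp; omega), yokeEntry_succ n a hj,
            yokeEntry_succ n b hj] at h2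
          rw [if_pos rfl] at h4
          linear_combination h4 + h2
        · have h5 := h3 (j + 1) (by omega) hji (by omega)
          rw [yokeEntry_succ n a hj, yokeEntry_succ n b hj] at h5
          rw [if_neg hji'] at h4
          linear_combination h4 + h5
  refine ⟨-k, le_of_eq ?_⟩
  have h6 : ∀ j ∈ Finset.range (m + 1), |a j - b j + -k * n| = if j = i then 1 else 0 := by
    intro j hj
    rw [key j (by simpa [Nat.lt_succ_iff] using hj)]
    split_ifs
    · rw [← hσ]; congr 1; ring
    · rw [abs_eq_zero]; ring
  rw [Finset.sum_congr rfl h6, Finset.sum_ite_eq', if_pos (Finset.mem_range.2 hi)]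

theorem exists_sum_le_length {n m : ℕ} (hn : 1 ≤ n) {u v : YokeVertex n m}
    (p : (yokeGraph n m).Walk u v) : ∀ {a b : ℕ → ℤ} (ha : IsStaircase m a) (hb : IsStaircase m b),
    u = yokeOf hn a ha → v = yokeOf hn b hb →
    ∃ k : ℤ, ∑ i ∈ Finset.range (m + 1), |a i - b i + k * n| ≤ p.length := by
  induction p with
  | nil =>
    rintro a b ha hb rfl h
    have hent : ∀ j < m + 2, yokeEntry n m a j = yokeEntry n m b j := fun j hj =>
      congrFun (congrArg Subtype.val h) ⟨j, hj⟩
    have h0 := hent 0 (by omega)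
    rw [yokeEntry_zero, yokeEntry_zero] at h0
    obtain ⟨k, hk⟩ := Int.ModEq.dvd (show a 0 ≡ b 0 [ZMOD n] from h0)
    refine ⟨k, le_of_eq (Finset.sum_eq_zero fun i hi => ?_)⟩
    rw [Finset.mem_range] at hi
    rw [abs_eq_zero]
    induction i with
    | zero => linear_combination -hk
    | succ i ih =>
      have h1 := hent (i + 1) (by omega)
      rw [yokeEntry_succ n a (by omega), yokeEntry_succ n b (by omega)] at h1
      linear_combination ih (by omega) + h1
  | @cons u w v huw p ih =>
    rintro a b ha hb rfl rfl
    obtain ⟨c, hc, rfl⟩ := exists_eq_yokeOf hn w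
    obtain ⟨k, hk⟩ := exists_sub_eq_of_adj hn huw
    obtain ⟨l, hl⟩ := ih hc hb rfl rfl
    refine ⟨k + l, ?_⟩
    rw [SimpleGraph.Walk.length_cons, Nat.cast_add, Nat.cast_one, add_comm (p.length : ℤ)]
    refine le_trans ?_ (add_le_add hk hl)
    rw [← Finset.sum_add_distrib]
    refine Finset.sum_le_sum fun i _ => le_of_eq_of_le ?_ (abs_add_le _ _)
    congr 1
    ring

/-! ### From the max-min value to the diameter -/

/-- Positive parts of the increments build `a`, negative parts build `b`. -/
theorem IsSlow.exists_sub_eq {m : ℕ} {d : ℕ → ℤ} (hd : IsSlow m d) :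
    ∃ a b : ℕ → ℤ, IsStaircase m a ∧ IsStaircase m b ∧ ∀ i, a i - b i = d i := by
  refine ⟨fun i => d 0 + ∑ j ∈ Finset.range i, max (d (j + 1) - d j) 0,
    fun i => ∑ j ∈ Finset.range i, max (-(d (j + 1) - d j)) 0, fun i hi => ?_, fun i hi => ?_,
    fun i => ?_⟩
  · have := abs_le.1 (hd i hi)
    beta_reduce
    rw [Finset.sum_range_succ]
    omega
  · have := abs_le.1 (hd i hi)
    beta_reduce
    rw [Finset.sum_range_succ]
    omega
  · induction i with
    | zero => simp
    | succ i ih =>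
      beta_reduce at ih ⊢
      rw [Finset.sum_range_succ, Finset.sum_range_succ]
      omega

theorem IsMaxMinSum.ediam_eq {n m D : ℕ} (hn : 1 ≤ n) (h : IsMaxMinSum n m D) :
    (yokeGraph n m).ediam = D := by
  refine le_antisymm (SimpleGraph.ediam_le_of_edist_le fun u v => ?_) ?_
  · obtain ⟨a, ha, rfl⟩ := exists_eq_yokeOf hn u
    obtain ⟨b, hb, rfl⟩ := exists_eq_yokeOf hn v
    obtain ⟨k, hk⟩ := h.le (fun i => a i - b i) fun i hi => by
      have := ha i hi
      have := hb i hi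
      beta_reduce
      rw [abs_le]
      omega
    have hc : IsStaircase m fun i => a i + k * n := fun i hi => by
      simpa only [add_sub_add_right_eq_sub] using ha i hi
    rw [yokeOf_eq_of_add_mul hn ha hc fun i _ => rfl]
    refine edist_yokeOf_le hn D hc hb (le_of_eq_of_le (Finset.sum_congr rfl fun i _ => ?_) hk)
    congr 1
    ring
  · obtain ⟨d, hd, hD⟩ := h.ge
    obtain ⟨a, b, ha, hb, hab⟩ := hd.exists_sub_eq
    refine le_trans (le_iInf fun p => ?_) (SimpleGraph.edist_le_ediam
      (u := yokeOf hn a ha) (v := yokeOf hn b hb))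
    obtain ⟨k, hk⟩ := exists_sum_le_length hn p ha hb rfl rfl
    simp only [hab] at hk
    exact_mod_cast (hD k).trans hk

theorem theorem1 (n m : ℕ) (hn : 1 ≤ n) :
    (m ≤ n → (yokeGraph n m).ediam = ((n * (m + 1) / 2 : ℕ) : ℕ∞)) ∧
    (n = 1 → 1 ≤ m →
      (yokeGraph n m).ediam =
        (((m ⌈/⌉ 2 + 1).choose 2 + (m / 2 + 1).choose 2 : ℕ) : ℕ∞)) ∧
    (1 < n → n ≤ m →
      ((2 ∣ m - n ∨ n ≤ (m + 1) ⌈/⌉ 2) →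
        (yokeGraph n m).ediam = (yokeD0 n m : ℕ∞)) ∧
      (¬ (2 ∣ m - n ∨ n ≤ (m + 1) ⌈/⌉ 2) →
        (yokeGraph n m).ediam = ((yokeD0 n m + (n - (m + 1) ⌈/⌉ 2) : ℕ) : ℕ∞))) := by
  refine ⟨fun h => (isMaxMinSum_of_le hn h).ediam_eq hn, ?_, fun _ h => ⟨fun h1 => ?_, fun h1 => ?_⟩⟩
  · rintro rfl h
    have h1 := (isMaxMinSum_of_ge le_rfl h).ediam_eq le_rfl
    rw [if_pos (Or.inr (by rw [Nat.ceilDiv_eq_add_pred_div]; omega)), add_zero] at h1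
    rw [h1, yokeD0]
    simp only [Nat.ceilDiv_eq_add_pred_div]
    congr 5
    omega
  · have h2 := (isMaxMinSum_of_ge hn h).ediam_eq hn
    rwa [if_pos h1, add_zero] at h2
  · have h2 := (isMaxMinSum_of_ge hn h).ediam_eq hn
    rwa [if_neg h1] at h2
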